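/- Let $p$ be a prime and let $\mathcal{L}_1=(\mathbb{Z}/p\mathbb{Z})\wr\mathbb{Z}=\bigl(\bigoplus_{\mathbb{Z}}\mathbb{Z}/p\mathbb{Z}\bigr)\rtimes\mathbb{Z}$, where $\mathbb{Z}$ acts by shifts. For a finitely generated group $H$ let $d(H)$ denote its minimal number of generators. Let $g:\mathbb{N}\to\mathbb{N}$ (with $0\in\mathbb{N}$) satisfy $g(0)=2$ and, for every $i\ge 0$, either $g(i+1)=g(i)$ or $g(i+1)=p\,g(i)-p+1$, and suppose that the set $\{i : g(i)=g(i+1)\}$ is infinite. Then there is a sequence $(H_i)_{i\ge 0}$ of finitely generated subgroups of $\mathcal{L}_1$ such that $H_0=\mathcal{L}_1$, each $H_{i+1}$ is a normal subgroup of $H_i$ of index $p$, $d(H_i)=g(i)$ for all $i\ge 0$, and $\bigcap_i H_i=\{1\}$. Moreover, the relative rank gradient function of this chain is $$rg(m):=\frac{d(H_m)-1}{[\mathcal{L}_1:H_m]}=\frac{g(m)-1}{p^m}\qquad(m\ge 0),$$ and $rg(m)\to 0$ as $m\to\infty$. -/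

import Mathlib

/-- The action of `ℤ` on `⨁_ℤ ℤ/p` by shifts: `s` sends the lamp configuration `v` to `x ^ s v`,
where `x` is the right shift by one, i.e. `(x ^ s v) j = v (j - s)`. -/
noncomputable def lampShift (p : ℕ) :
    Multiplicative ℤ →* MulAut (Multiplicative (ℤ →₀ ZMod p)) where
  toFun s := AddEquiv.toMultiplicative (Finsupp.domCongr (Equiv.addRight s.toAdd))
  map_one' := by
    ext v j
    change v.toAdd (j - 0) = v.toAdd j
    rw [sub_zero]
  map_mul' s t := by
    ext v j
    change v.toAdd (j - (s.toAdd + t.toAdd)) = v.toAdd (j - s.toAdd - t.toAdd)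
    rw [sub_sub]

/-- The lamplighter group `𝓛₁ = (ℤ/p) ≀ ℤ = (⨁_ℤ ℤ/p) ⋊ ℤ` (restricted wreath product):
pairs `(v, s)` with `(v, s) (w, t) = (v + x ^ s w, s + t)`. -/
abbrev Lamplighter (p : ℕ) : Type :=
  Multiplicative (ℤ →₀ ZMod p) ⋊[lampShift p] Multiplicative ℤ

/-- A sequence of subgroups `H 0 ≥ H 1 ≥ H 2 ≥ ⋯` of `G` is a descending subnormal `p`-chain if
each `H (i + 1)` is a normal subgroup of `H i` of index `p`. -/
structure IsSubnormalPChain {G : Type*} [Group G] (p : ℕ) (H : ℕ → Subgroup G) : Prop where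
  le : ∀ i, H (i + 1) ≤ H i
  normal : ∀ i, ((H (i + 1)).subgroupOf (H i)).Normal
  index : ∀ i, (H (i + 1)).relIndex (H i) = p

/-- The relative rank gradient function `rg(m) = (d(H m) - 1) / [G : H m]` of a sequence of finitely
generated subgroups, where `d` is the minimal number of generators. -/
noncomputable def relativeRankGradient {G : Type*} [Group G] (H : ℕ → Subgroup G)
    [∀ i, Group.FG (H i)] (m : ℕ) : ℝ :=
  ((Group.rank (H m) : ℝ) - 1) / ((H m).index : ℝ)

/-! Writing `x = 1 + X` embeds the lamp group, the Laurent polynomials in `x`, densely into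
`𝔽_p⟦X⟧`, on which `(v, s)` acts by `G ↦ (1 + X) ^ s * G + v`. For a fixed series `F`, `lampSubgroup
F k j` consists of the elements with `p ^ k ∣ s` that fix `-F` modulo `X ^ j`. Since `(1 + X) ^ p ^
k = 1 + X ^ p ^ k`, this subgroup acts trivially on lamps modulo `X ^ p ^ k`; hence it maps onto an
elementary abelian group of rank `p ^ k + 1`, and that many generators suffice
(`rank_lampSubgroup`). Raising `j` by one gives index `p` with the same rank; raising `k` by one
gives index `p` and sends the rank `r` to `p * r - p + 1`. The sequence `g` dictates which to raise.
As `j → ∞`, the intersection fixes `-F` exactly. Because `k` may stay bounded, nonzero shifts must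
be excluded by the choice of `F`, which a countability argument provides. -/

open PowerSeries

/-! ### Laurent polynomials inside `𝔽_p⟦X⟧` -/

section PowerSeriesExpansion

variable (p : ℕ) [Fact p.Prime]

/-- The unit `1 + X` of `𝔽_p⟦X⟧`. -/
noncomputable def oneAddXUnit : (ZMod p)⟦X⟧ˣ :=
  (PowerSeries.isUnit_iff_constantCoeff.2 (by simp) : IsUnit (1 + X : (ZMod p)⟦X⟧)).unit

@[simp]
theorem coe_oneAddXUnit : (oneAddXUnit p : (ZMod p)⟦X⟧) = 1 + X := rfl

/-- The embedding of `𝔽_p[x, x⁻¹]` into `𝔽_p⟦X⟧` with `x ↦ 1 + X`. -/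
noncomputable def lampExpansion : (ℤ →₀ ZMod p) →ₗ[ZMod p] (ZMod p)⟦X⟧ :=
  Finsupp.linearCombination (ZMod p) fun n : ℤ => ((oneAddXUnit p ^ n : (ZMod p)⟦X⟧ˣ) : (ZMod p)⟦X⟧)

variable {p}

theorem lampExpansion_single (n : ℤ) (c : ZMod p) :
    lampExpansion p (Finsupp.single n c) = c • ((oneAddXUnit p ^ n : (ZMod p)⟦X⟧ˣ) : (ZMod p)⟦X⟧) := by
  simp [lampExpansion, Finsupp.linearCombination_single]

theorem lampExpansion_shift (s : ℤ) (f : ℤ →₀ ZMod p) :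
    lampExpansion p (Finsupp.domCongr (Equiv.addRight s) f) =
      ((oneAddXUnit p ^ s : (ZMod p)⟦X⟧ˣ) : (ZMod p)⟦X⟧) * lampExpansion p f := by
  induction f using Finsupp.induction_linear with
  | zero => simp
  | add f g hf hg => rw [map_add, map_add, map_add, hf, hg, mul_add]
  | single a c =>
    have : Finsupp.domCongr (Equiv.addRight s) (Finsupp.single a c) = Finsupp.single (a + s) c := by
      simp [Finsupp.domCongr]
    rw [this, lampExpansion_single, lampExpansion_single, add_comm, zpow_add, Units.val_mul,
      mul_smul_comm]

/-- A high power of `x` clears the negative exponents. Allowing every large `n` makes sums work and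
later lets `n` be a multiple of `p ^ k`. -/
theorem exists_polynomial_eq_oneAddX_pow_mul_lampExpansion (f : ℤ →₀ ZMod p) :
    ∃ n₀ : ℕ, ∀ n ≥ n₀, ∃ P : Polynomial (ZMod p),
      ((oneAddXUnit p ^ (n : ℤ) : (ZMod p)⟦X⟧ˣ) : (ZMod p)⟦X⟧) * lampExpansion p f =
        (P.comp (1 + Polynomial.X) : Polynomial (ZMod p)) ∧
      (∀ m : ℕ, P.coeff m = f (m - n)) ∧ ∀ a : ℤ, a < -n → f a = 0 := by
  induction f using Finsupp.induction_linear with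
  | zero => exact ⟨0, fun n _ => ⟨0, by simp⟩⟩
  | add f g hf hg =>
    obtain ⟨a, ha⟩ := hf
    obtain ⟨b, hb⟩ := hg
    refine ⟨max a b, fun n hn => ?_⟩
    obtain ⟨P, h1, h2, h3⟩ := ha n (le_trans (le_max_left _ _) hn)
    obtain ⟨Q, k1, k2, k3⟩ := hb n (le_trans (le_max_right _ _) hn)
    refine ⟨P + Q, ?_, fun m => ?_, fun a ha => ?_⟩
    · rw [map_add, mul_add, h1, k1, Polynomial.add_comp, Polynomial.coe_add]
    · rw [Polynomial.coeff_add, h2, k2, Finsupp.add_apply]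
    · rw [Finsupp.add_apply, h3 a ha, k3 a ha, add_zero]
  | single a c =>
    refine ⟨a.natAbs, fun n hn => ⟨Polynomial.monomial (n + a).toNat c, ?_, fun m => ?_,
      fun b hb => ?_⟩⟩
    · have h : (n : ℤ) + a = ((n + a).toNat : ℤ) := by omega
      rw [lampExpansion_single, mul_smul_comm, ← Units.val_mul, ← zpow_add, h, zpow_natCast,
        Polynomial.monomial_comp, Units.val_pow_eq_pow_val, coe_oneAddXUnit]
      simp only [Polynomial.coe_mul, Polynomial.coe_C, Polynomial.coe_pow, Polynomial.coe_add,
        Polynomial.coe_one, Polynomial.coe_X, smul_eq_C_mul, Int.toNat_natCast]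
    · rw [Polynomial.coeff_monomial, Finsupp.single_apply]
      congr 1
      apply propext
      omega
    · rw [Finsupp.single_apply, if_neg]
      omega

theorem lampExpansion_injective : Function.Injective (lampExpansion p) := by
  rw [injective_iff_map_eq_zero]
  intro f hf
  obtain ⟨n, hn⟩ := exists_polynomial_eq_oneAddX_pow_mul_lampExpansion f
  obtain ⟨P, h1, h2, h3⟩ := hn n le_rfl
  have hP : P = 0 := by
    rw [hf, mul_zero, eq_comm, Polynomial.coe_eq_zero_iff, Polynomial.comp_eq_zero_iff] at h1
    rcases h1 with h | ⟨-, h⟩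
    · exact h
    · have := congrArg (fun Q => Polynomial.coeff Q 1) h
      simp [Polynomial.coeff_one] at this
  ext a
  by_cases ha : a < -n
  · simp [h3 a ha]
  · have := h2 (a + n).toNat
    rw [hP, Polynomial.coeff_zero] at this
    rw [Finsupp.zero_apply, this]
    congr 1
    omega

theorem exists_lampExpansion_eq_X_pow (j : ℕ) : ∃ f, lampExpansion p f = X ^ j := by
  induction j with
  | zero => exact ⟨Finsupp.single 0 1, by simp [lampExpansion_single]⟩
  | succ j ih =>
    obtain ⟨f, hf⟩ := ih
    refine ⟨Finsupp.domCongr (Equiv.addRight 1) f - f, ?_⟩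
    rw [map_sub, lampExpansion_shift, hf, zpow_one, coe_oneAddXUnit]
    ring

/-- Density in the `X`-adic topology: the error is corrected one coefficient at a time. -/
theorem exists_X_pow_dvd_lampExpansion_sub (G : (ZMod p)⟦X⟧) (j : ℕ) :
    ∃ f, X ^ j ∣ lampExpansion p f - G := by
  induction j with
  | zero => exact ⟨0, by simp⟩
  | succ j ih =>
    obtain ⟨f, D, hD⟩ := ih
    obtain ⟨g, hg⟩ := exists_lampExpansion_eq_X_pow (p := p) j
    refine ⟨f - constantCoeff D • g, ?_⟩
    have : X ∣ D - C (constantCoeff D) := by simp [X_dvd_iff]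
    obtain ⟨E, hE⟩ := this
    refine ⟨E, ?_⟩
    rw [map_sub, map_smul, hg, smul_eq_C_mul]
    linear_combination hD + X ^ j * hE

theorem oneAddXUnit_zpow_ne_one {s : ℤ} (hs : s ≠ 0) : oneAddXUnit p ^ s ≠ 1 := by
  intro h
  have h1 : lampExpansion p (Finsupp.single s 1) = lampExpansion p (Finsupp.single 0 1) := by
    rw [lampExpansion_single, lampExpansion_single, h, zpow_zero]
  exact hs ((Finsupp.single_left_inj one_ne_zero).1 (lampExpansion_injective h1))

theorem oneAddXUnit_pow_prime_pow (k : ℕ) :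
    ((oneAddXUnit p ^ (p ^ k) : (ZMod p)⟦X⟧ˣ) : (ZMod p)⟦X⟧) = 1 + X ^ p ^ k := by
  have : CharP (ZMod p)⟦X⟧ p := charP_of_injective_algebraMap
    (algebraMap (ZMod p) (ZMod p)⟦X⟧).injective p
  rw [Units.val_pow_eq_pow_val, coe_oneAddXUnit, add_pow_char_pow, one_pow]

theorem X_pow_dvd_oneAddXUnit_zpow_sub_one {k : ℕ} {s : ℤ} (h : ((p ^ k : ℕ) : ℤ) ∣ s) :
    X ^ p ^ k ∣ ((oneAddXUnit p ^ s : (ZMod p)⟦X⟧ˣ) : (ZMod p)⟦X⟧) - 1 := by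
  obtain ⟨m, rfl⟩ := h
  -- Units congruent to 1 modulo `X ^ p ^ k` form a subgroup, which also covers negative `m`.
  set π := Ideal.Quotient.mk (Ideal.span {(X ^ p ^ k : (ZMod p)⟦X⟧)})
  have key (w : (ZMod p)⟦X⟧ˣ) :
      w ∈ (Units.map π.toMonoidHom).ker ↔ X ^ p ^ k ∣ (w : (ZMod p)⟦X⟧) - 1 := by
    rw [MonoidHom.mem_ker, Units.ext_iff, ← Ideal.mem_span_singleton, ← Ideal.Quotient.eq]
    simp [π]
  rw [zpow_mul, ← key]
  refine zpow_mem ?_ m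
  rw [key, zpow_natCast, oneAddXUnit_pow_prime_pow]
  simp

/-- Each of the countably many pairs `(s, f)` excludes at most one `F`, while `𝔽_p⟦X⟧` is
uncountable. -/
theorem exists_forall_zpow_sub_one_mul_ne_lampExpansion :
    ∃ F : (ZMod p)⟦X⟧, ∀ s : ℤ, s ≠ 0 → ∀ f,
      (((oneAddXUnit p ^ s : (ZMod p)⟦X⟧ˣ) : (ZMod p)⟦X⟧) - 1) * F ≠ lampExpansion p f := by
  by_contra! hcon
  have hc : (Set.univ : Set (ZMod p)⟦X⟧).Countable := by
    refine (Set.countable_iUnion (fun x : {s : ℤ // s ≠ 0} × (ℤ →₀ ZMod p) =>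
      Set.Subsingleton.countable (s := {F : (ZMod p)⟦X⟧ |
        (((oneAddXUnit p ^ x.1.1 : (ZMod p)⟦X⟧ˣ) : (ZMod p)⟦X⟧) - 1) * F =
          lampExpansion p x.2}) ?_)).mono ?_
    · intro F hF G hG
      refine mul_left_cancel₀ ?_ (Eq.trans hF (Eq.symm hG))
      rw [sub_ne_zero, Ne, Units.val_eq_one]
      exact oneAddXUnit_zpow_ne_one x.1.2
    · intro F _
      obtain ⟨s, hs, f, hf⟩ := hcon F
      exact Set.mem_iUnion.2 ⟨⟨⟨s, hs⟩, f⟩, hf⟩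
  have hc' : Countable (ZMod p)⟦X⟧ := Set.countable_univ_iff.1 hc
  obtain ⟨φ, hφ⟩ := exists_surjective_nat (ZMod p)⟦X⟧
  -- Cantor's diagonal: this series differs from `φ n` in degree `n`.
  obtain ⟨n, hn⟩ := hφ (PowerSeries.mk fun i => coeff i (φ i) + 1)
  simpa using congrArg (coeff n) hn

end PowerSeriesExpansion

/-! ### Rank and index in general groups -/

section Groups

/-- The images of generators span `V`. -/
theorem finrank_le_rank_of_surjective {G V : Type*} (p : ℕ) [Fact p.Prime] [Group G] [Group.FG G]
    [AddCommGroup V] [Module (ZMod p) V] (φ : G →* Multiplicative V)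
    (hφ : Function.Surjective φ) : Module.finrank (ZMod p) V ≤ Group.rank G := by
  classical
  obtain ⟨S, hS, hcl⟩ := Group.rank_spec G
  set T : Finset V := S.image fun a => (φ a).toAdd
  have hspan : Submodule.span (ZMod p) (T : Set V) = ⊤ := by
    rw [eq_top_iff]
    rintro v -
    obtain ⟨a, ha⟩ := hφ (Multiplicative.ofAdd v)
    have key : ∀ a ∈ Subgroup.closure (S : Set G),
        (φ a).toAdd ∈ Submodule.span (ZMod p) (T : Set V) := by
      intro a ha
      induction ha using Subgroup.closure_induction with
      | mem x hx => exact Submodule.subset_span (Finset.mem_image_of_mem _ hx)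
      | one => simp
      | mul x y _ _ hx hy => rw [map_mul, toAdd_mul]; exact add_mem hx hy
      | inv x _ hx => rw [map_inv, toAdd_inv]; exact neg_mem hx
    have := key a (hcl ▸ Subgroup.mem_top a)
    rwa [ha, toAdd_ofAdd] at this
  calc Module.finrank (ZMod p) V = (T : Set V).finrank (ZMod p) := by
        rw [Set.finrank, hspan, finrank_top]
    _ ≤ T.card := finrank_span_finset_le_card T
    _ ≤ S.card := Finset.card_image_le
    _ = Group.rank G := hS

theorem relIndex_eq_of_ker_eq {G : Type*} [Group G] {H K : Subgroup G} {p : ℕ}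
    (φ : H →* Multiplicative (ZMod p)) (hφ : Function.Surjective φ)
    (hker : φ.ker = K.subgroupOf H) : K.relIndex H = p := by
  rw [Subgroup.relIndex, ← hker, Subgroup.index_ker, MonoidHom.range_eq_top.2 hφ,
    Subgroup.card_top]
  exact Nat.card_zmod p

theorem IsSubnormalPChain.index_eq {G : Type*} [Group G] {p : ℕ} {H : ℕ → Subgroup G}
    (h : IsSubnormalPChain p H) (h0 : H 0 = ⊤) (m : ℕ) : (H m).index = p ^ m := by
  induction m with
  | zero => simp [h0]
  | succ m ih => rw [← Subgroup.relIndex_mul_index (h.le m), h.index, ih, pow_succ']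

end Groups

/-! ### The subgroups and their index-`p` inclusions -/

section LamplighterSubgroups

variable {p : ℕ} [Fact p.Prime] (F : (ZMod p)⟦X⟧)

/-- The crossed homomorphism `(v, s) ↦ v - ((1 + X) ^ s - 1) F` from the lamplighter group to
`𝔽_p⟦X⟧`, where lamp configurations are expanded by `x ↦ 1 + X`. -/
noncomputable def lampTwist (a : Lamplighter p) : (ZMod p)⟦X⟧ :=
  lampExpansion p a.left.toAdd -
    (((oneAddXUnit p ^ a.right.toAdd : (ZMod p)⟦X⟧ˣ) : (ZMod p)⟦X⟧) - 1) * F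

theorem lampTwist_mul (a b : Lamplighter p) :
    lampTwist F (a * b) = lampTwist F a +
      ((oneAddXUnit p ^ a.right.toAdd : (ZMod p)⟦X⟧ˣ) : (ZMod p)⟦X⟧) * lampTwist F b := by
  have h : lampExpansion p (a * b).left.toAdd = lampExpansion p a.left.toAdd +
      ((oneAddXUnit p ^ a.right.toAdd : (ZMod p)⟦X⟧ˣ) : (ZMod p)⟦X⟧) *
        lampExpansion p b.left.toAdd := by
    rw [← lampExpansion_shift, ← map_add]
    rfl
  rw [lampTwist, lampTwist, lampTwist, h, SemidirectProduct.mul_right, toAdd_mul, zpow_add,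
    Units.val_mul]
  ring

theorem lampTwist_one : lampTwist F (1 : Lamplighter p) = 0 := by
  simp [lampTwist]

theorem lampTwist_inv (a : Lamplighter p) : lampTwist F a⁻¹ =
    -(((oneAddXUnit p ^ (-a.right.toAdd) : (ZMod p)⟦X⟧ˣ) : (ZMod p)⟦X⟧) * lampTwist F a) := by
  have h := lampTwist_mul F a⁻¹ a
  rw [inv_mul_cancel, lampTwist_one, SemidirectProduct.inv_right, toAdd_inv] at h
  exact eq_neg_of_add_eq_zero_left h.symm

/-- The subgroup of those `(v, s)` with `p ^ k ∣ s` and `v ≡ ((1 + X) ^ s - 1) F` modulo `X ^ j`. -/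
noncomputable def lampSubgroup (k j : ℕ) : Subgroup (Lamplighter p) where
  carrier := {a | ((p ^ k : ℕ) : ℤ) ∣ a.right.toAdd ∧ X ^ j ∣ lampTwist F a}
  one_mem' := ⟨by simp, by simp [lampTwist_one]⟩
  mul_mem' {a b} ha hb := by
    refine ⟨?_, ?_⟩
    · rw [SemidirectProduct.mul_right, toAdd_mul]
      exact dvd_add ha.1 hb.1
    · rw [lampTwist_mul]
      exact dvd_add ha.2 (hb.2.mul_left _)
  inv_mem' {a} ha := by
    refine ⟨?_, ?_⟩
    · rw [SemidirectProduct.inv_right, toAdd_inv]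
      exact (dvd_neg.2 ha.1)
    · rw [lampTwist_inv]
      exact dvd_neg.2 (ha.2.mul_left _)

theorem mem_lampSubgroup {k j : ℕ} {a : Lamplighter p} : a ∈ lampSubgroup F k j ↔
    ((p ^ k : ℕ) : ℤ) ∣ a.right.toAdd ∧ X ^ j ∣ lampTwist F a := Iff.rfl

theorem lampSubgroup_zero_zero : lampSubgroup F 0 0 = ⊤ := by
  ext a
  simp [mem_lampSubgroup]

theorem exists_lampTwist (s : ℤ) (G : (ZMod p)⟦X⟧) (n : ℕ) :
    ∃ a : Lamplighter p, a.right.toAdd = s ∧ X ^ n ∣ lampTwist F a - G := by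
  obtain ⟨f, hf⟩ := exists_X_pow_dvd_lampExpansion_sub
    ((((oneAddXUnit p ^ s : (ZMod p)⟦X⟧ˣ) : (ZMod p)⟦X⟧) - 1) * F + G) n
  refine ⟨⟨Multiplicative.ofAdd f, Multiplicative.ofAdd s⟩, rfl, ?_⟩
  rw [lampTwist]
  simpa only [toAdd_ofAdd, sub_sub] using hf

/-- The homomorphism from `lampSubgroup F k j` to an elementary abelian group of rank `p ^ k + 1`
that records the coefficients of `lampTwist` in degrees `j, …, j + p ^ k - 1` and the shift. -/
noncomputable def lampSubgroupHom (k j : ℕ) :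
    lampSubgroup F k j →* Multiplicative ((Fin (p ^ k) → ZMod p) × ZMod p) where
  toFun a := Multiplicative.ofAdd
    (fun i => coeff (j + i) (lampTwist F a.1), ((a.1.right.toAdd / (p ^ k : ℕ) : ℤ) : ZMod p))
  map_one' := by
    simp [lampTwist_one]
    rfl
  map_mul' a b := by
    rw [← ofAdd_add]
    congr 1
    refine Prod.ext (funext fun i => ?_) ?_
    -- The crossed term differs from `lampTwist F b` only in degrees at least `j + p ^ k`, beyond
    -- the recorded window.
    · have h : X ^ (p ^ k + j) ∣
          (((oneAddXUnit p ^ a.1.right.toAdd : (ZMod p)⟦X⟧ˣ) : (ZMod p)⟦X⟧) - 1) *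
            lampTwist F b.1 := by
        rw [pow_add]
        exact mul_dvd_mul (X_pow_dvd_oneAddXUnit_zpow_sub_one a.2.1) b.2.2
      have h1 := X_pow_dvd_iff.1 h (j + i) (by omega)
      rw [sub_mul, one_mul, map_sub, sub_eq_zero] at h1
      simp only [Subgroup.coe_mul, lampTwist_mul, map_add, h1, Prod.fst_add, Pi.add_apply]
    · simp only [Subgroup.coe_mul, SemidirectProduct.mul_right, toAdd_mul, Prod.snd_add]
      rw [Int.add_ediv_of_dvd_left a.2.1, Int.cast_add]

theorem lampSubgroupHom_surjective (k j : ℕ) : Function.Surjective (lampSubgroupHom F k j) := by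
  intro y
  obtain ⟨⟨v, c⟩, rfl⟩ := Multiplicative.ofAdd.surjective y
  obtain ⟨m, rfl⟩ := ZMod.intCast_surjective c
  set D : (ZMod p)⟦X⟧ := PowerSeries.mk fun i => if h : i < p ^ k then v ⟨i, h⟩ else 0
  obtain ⟨a, has, hat⟩ := exists_lampTwist F ((p ^ k : ℕ) * m) (X ^ j * D) (j + p ^ k)
  have hpk : ((p ^ k : ℕ) : ℤ) ≠ 0 := by
    exact_mod_cast pow_ne_zero k (Fact.out : p.Prime).ne_zero
  have hX : X ^ j ∣ lampTwist F a :=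
    (dvd_sub_left (dvd_mul_right _ _)).1 ((pow_dvd_pow X (Nat.le_add_right j _)).trans hat)
  refine ⟨⟨a, has ▸ dvd_mul_right _ _, hX⟩, ?_⟩
  refine congrArg Multiplicative.ofAdd (Prod.ext (funext fun i => ?_) ?_)
  · have := X_pow_dvd_iff.1 hat (j + i) (by omega)
    rw [map_sub, sub_eq_zero] at this
    simp only [this]
    rw [add_comm, coeff_X_pow_mul, coeff_mk, dif_pos i.2]
  · simp only [has]
    rw [Int.mul_ediv_cancel_left _ hpk]

/-- The smaller subgroup is the kernel of the coefficient in degree `j`. -/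
theorem lampSubgroup_succ_right (k j : ℕ) :
    lampSubgroup F k (j + 1) ≤ lampSubgroup F k j ∧
    ((lampSubgroup F k (j + 1)).subgroupOf (lampSubgroup F k j)).Normal ∧
    (lampSubgroup F k (j + 1)).relIndex (lampSubgroup F k j) = p := by
  have hq : 0 < p ^ k := pow_pos (Fact.out : p.Prime).pos k
  set φ : lampSubgroup F k j →* Multiplicative (ZMod p) :=
    (AddMonoidHom.toMultiplicative ((Pi.evalAddMonoidHom _ (⟨0, hq⟩ : Fin (p ^ k))).comp
      (AddMonoidHom.fst _ _))).comp (lampSubgroupHom F k j)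
  have hker : φ.ker = (lampSubgroup F k (j + 1)).subgroupOf (lampSubgroup F k j) := by
    ext ⟨a, ha⟩
    rw [MonoidHom.mem_ker, Subgroup.mem_subgroupOf, mem_lampSubgroup]
    change coeff (j + 0) (lampTwist F a) = 0 ↔ _
    simp only [ha.1, true_and, add_zero]
    rw [X_pow_dvd_iff]
    refine ⟨fun h m hm => ?_, fun h => h j j.lt_succ_self⟩
    rcases Nat.lt_succ_iff_lt_or_eq.1 hm with hm | rfl
    · exact X_pow_dvd_iff.1 ha.2 m hm
    · exact h
  refine ⟨fun a ha => ⟨ha.1, (pow_dvd_pow X j.le_succ).trans ha.2⟩, hker ▸ φ.normal_ker,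
    relIndex_eq_of_ker_eq φ ?_ hker⟩
  intro c
  obtain ⟨a, ha⟩ := lampSubgroupHom_surjective F k j (Multiplicative.ofAdd (fun _ => c.toAdd, 0))
  exact ⟨a, congrArg (fun y => Multiplicative.ofAdd (y.toAdd.1 ⟨0, hq⟩)) ha⟩

/-- The smaller subgroup is the kernel of the shift divided by `p ^ k`, modulo `p`. -/
theorem lampSubgroup_succ_left (k j : ℕ) :
    lampSubgroup F (k + 1) j ≤ lampSubgroup F k j ∧
    ((lampSubgroup F (k + 1) j).subgroupOf (lampSubgroup F k j)).Normal ∧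
    (lampSubgroup F (k + 1) j).relIndex (lampSubgroup F k j) = p := by
  have hpk : ((p ^ k : ℕ) : ℤ) ≠ 0 := by
    exact_mod_cast pow_ne_zero k (Fact.out : p.Prime).ne_zero
  set φ : lampSubgroup F k j →* Multiplicative (ZMod p) :=
    (AddMonoidHom.toMultiplicative (AddMonoidHom.snd _ _)).comp (lampSubgroupHom F k j)
  have hker : φ.ker = (lampSubgroup F (k + 1) j).subgroupOf (lampSubgroup F k j) := by
    ext ⟨a, ha⟩
    rw [MonoidHom.mem_ker, Subgroup.mem_subgroupOf, mem_lampSubgroup]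
    change ((a.right.toAdd / (p ^ k : ℕ) : ℤ) : ZMod p) = 0 ↔ _
    simp only [ha.2, and_true]
    obtain ⟨m, hm⟩ := ha.1
    rw [hm, Int.mul_ediv_cancel_left _ hpk, ZMod.intCast_zmod_eq_zero_iff_dvd, pow_succ,
      Nat.cast_mul, mul_dvd_mul_iff_left hpk]
  refine ⟨fun a ha => ⟨?_, ha.2⟩, hker ▸ φ.normal_ker, relIndex_eq_of_ker_eq φ ?_ hker⟩
  · exact dvd_trans (by exact_mod_cast pow_dvd_pow p k.le_succ) ha.1
  · intro c
    obtain ⟨a, ha⟩ := lampSubgroupHom_surjective F k j (Multiplicative.ofAdd (0, c.toAdd))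
    exact ⟨a, congrArg (fun y => Multiplicative.ofAdd y.toAdd.2) ha⟩

end LamplighterSubgroups

/-! ### Generators, rank and intersection -/

section LamplighterRank

theorem Lamplighter.mul_inl_mul_inv {p : ℕ} (b : Lamplighter p)
    (v : Multiplicative (ℤ →₀ ZMod p)) :
    b * SemidirectProduct.inl v * b⁻¹ = SemidirectProduct.inl (lampShift p b.right v) := by
  conv_lhs => rw [← SemidirectProduct.inl_left_mul_inr_right b]
  rw [mul_inv_rev, ← map_inv SemidirectProduct.inr]
  calc _ = SemidirectProduct.inl b.left * (SemidirectProduct.inr b.right *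
        SemidirectProduct.inl v * SemidirectProduct.inr b.right⁻¹) *
        (SemidirectProduct.inl b.left)⁻¹ := by group
    _ = _ := by
      rw [← SemidirectProduct.inl_aut, ← map_inv SemidirectProduct.inl, ← map_mul, ← map_mul,
        mul_inv_cancel_comm]

variable {p : ℕ} [Fact p.Prime]

theorem lampExpansion_lampShift (s : Multiplicative ℤ) (f : ℤ →₀ ZMod p) :
    lampExpansion p (lampShift p s (Multiplicative.ofAdd f)).toAdd =
      ((oneAddXUnit p ^ s.toAdd : (ZMod p)⟦X⟧ˣ) : (ZMod p)⟦X⟧) * lampExpansion p f :=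
  lampExpansion_shift _ _

theorem lampTwist_inl (F : (ZMod p)⟦X⟧) (v : Multiplicative (ℤ →₀ ZMod p)) :
    lampTwist F (SemidirectProduct.inl v) = lampExpansion p v.toAdd := by
  simp [lampTwist]

theorem Lamplighter.right_zpow {p : ℕ} (b : Lamplighter p) (m : ℤ) :
    (b ^ m).right.toAdd = m * b.right.toAdd := by
  have h : (b ^ m).right = b.right ^ m :=
    map_zpow (SemidirectProduct.rightHom : Lamplighter p →* _) b m
  rw [h, toAdd_zpow, smul_eq_mul]

/-- A subgroup of the lamplighter group that projects onto `p ^ k ℤ` and contains lamp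
configurations `X ^ j, …, X ^ (j + p ^ k - 1)` contains all configurations divisible by `X ^ j`. -/
theorem inl_mem_of_X_pow_dvd {k j : ℕ} {K : Subgroup (Lamplighter p)} {b : Lamplighter p}
    (hb : b ∈ K) (hbr : b.right.toAdd = (p ^ k : ℕ))
    (hK : ∀ i < p ^ k, ∃ f : ℤ →₀ ZMod p,
      SemidirectProduct.inl (Multiplicative.ofAdd f) ∈ K ∧ lampExpansion p f = X ^ (j + i))
    {f : ℤ →₀ ZMod p} (hf : X ^ j ∣ lampExpansion p f) :
    SemidirectProduct.inl (Multiplicative.ofAdd f) ∈ K := by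
  have hpow (n : ℕ) : ∃ f : ℤ →₀ ZMod p,
      SemidirectProduct.inl (Multiplicative.ofAdd f) ∈ K ∧ lampExpansion p f = X ^ (j + n) := by
    induction n using Nat.strong_induction_on with
    | _ n ih =>
      by_cases hn : n < p ^ k
      · exact hK n hn
      obtain ⟨m, rfl⟩ := Nat.exists_eq_add_of_le' (not_lt.1 hn)
      obtain ⟨f, hf, hfe⟩ := ih m (Nat.lt_add_of_pos_right (pow_pos (Fact.out : p.Prime).pos k))
      -- The commutator with `b` multiplies lamps by `(1 + X) ^ p ^ k - 1 = X ^ p ^ k`.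
      refine ⟨(lampShift p b.right (Multiplicative.ofAdd f)).toAdd - f, ?_, ?_⟩
      · rw [ofAdd_sub, map_div, ofAdd_toAdd, ← Lamplighter.mul_inl_mul_inv]
        exact K.div_mem (K.mul_mem (K.mul_mem hb hf) (K.inv_mem hb)) hf
      · rw [map_sub, lampExpansion_lampShift, hfe, hbr, zpow_natCast, oneAddXUnit_pow_prime_pow]
        ring
  have hpoly (Q : Polynomial (ZMod p)) : ∃ f : ℤ →₀ ZMod p,
      SemidirectProduct.inl (Multiplicative.ofAdd f) ∈ K ∧ lampExpansion p f = X ^ j * (Q : (ZMod p)⟦X⟧) := by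
    induction Q using Polynomial.induction_on' with
    | add P Q hP hQ =>
      obtain ⟨f, hf, hfe⟩ := hP
      obtain ⟨g, hg, hge⟩ := hQ
      refine ⟨f + g, ?_, ?_⟩
      · rw [ofAdd_add, map_mul]
        exact K.mul_mem hf hg
      · rw [map_add, hfe, hge, Polynomial.coe_add, mul_add]
    | monomial n c =>
      obtain ⟨f, hf, hfe⟩ := hpow n
      obtain ⟨c, rfl⟩ := ZMod.natCast_zmod_surjective c
      refine ⟨c • f, ?_, ?_⟩
      · rw [ofAdd_nsmul, map_pow]
        exact K.pow_mem hf c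
      · rw [map_nsmul, hfe, ← Polynomial.C_mul_X_pow_eq_monomial, Polynomial.coe_mul,
          Polynomial.coe_C, Polynomial.coe_pow, Polynomial.coe_X, map_natCast, nsmul_eq_mul]
        ring
  obtain ⟨n, hn⟩ := exists_polynomial_eq_oneAddX_pow_mul_lampExpansion f
  -- With exponent `n * p ^ k`, conjugation by `b ^ n` performs the shift; it can be undone inside
  -- `K`.
  obtain ⟨P, hP, -, -⟩ := hn (n * p ^ k) (Nat.le_mul_of_pos_right n
    (pow_pos (Fact.out : p.Prime).pos k))
  have hdvd : Polynomial.X ^ j ∣ P.comp (1 + Polynomial.X) := by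
    rw [Polynomial.X_pow_dvd_iff]
    intro d hd
    rw [← Polynomial.coeff_coe, ← hP]
    exact X_pow_dvd_iff.1 (hf.mul_left _) d hd
  obtain ⟨Q, hQ⟩ := hdvd
  obtain ⟨g, hg, hge⟩ := hpoly Q
  have hbn : (b ^ (n : ℤ)).right.toAdd = (n * p ^ k : ℕ) := by
    rw [Lamplighter.right_zpow, hbr, Nat.cast_mul]
  have hgf : Multiplicative.ofAdd g =
      lampShift p (b ^ (n : ℤ)).right (Multiplicative.ofAdd f) := by
    refine Multiplicative.toAdd.injective (lampExpansion_injective ?_)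
    rw [lampExpansion_lampShift, hbn, hP, hQ, toAdd_ofAdd, hge, Polynomial.coe_mul,
      Polynomial.coe_pow, Polynomial.coe_X]
  have hb' := K.zpow_mem hb n
  rw [hgf, ← Lamplighter.mul_inl_mul_inv, K.mul_mem_cancel_right (K.inv_mem hb'),
    K.mul_mem_cancel_left hb'] at hg
  exact hg

/-- One element `b` of shift `p ^ k` and the lamps `X ^ j, …, X ^ (j + p ^ k - 1)` generate:
dividing by a power of `b` leaves a pure lamp configuration. -/
theorem exists_closure_eq_lampSubgroup (F : (ZMod p)⟦X⟧) (k j : ℕ) :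
    ∃ S : Finset (Lamplighter p), S.card ≤ p ^ k + 1 ∧
      Subgroup.closure (S : Set (Lamplighter p)) = lampSubgroup F k j := by
  classical
  choose f hf using fun i => exists_lampExpansion_eq_X_pow (p := p) i
  obtain ⟨b, hbr, hbt⟩ := exists_lampTwist F (p ^ k : ℕ) 0 j
  rw [sub_zero] at hbt
  set a : ℕ → Lamplighter p := fun i => SemidirectProduct.inl (Multiplicative.ofAdd (f (j + i)))
  set S : Finset (Lamplighter p) := insert b ((Finset.range (p ^ k)).image a)
  refine ⟨S, (Finset.card_insert_le _ _).trans (Nat.succ_le_succ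
    (Finset.card_image_le.trans (Finset.card_range _).le)), le_antisymm ?_ fun h hh => ?_⟩
  · have hbmem : b ∈ lampSubgroup F k j := ⟨hbr ▸ dvd_rfl, hbt⟩
    have hamem (i : ℕ) : a i ∈ lampSubgroup F k j := by
      refine ⟨dvd_zero _, ?_⟩
      rw [lampTwist_inl, toAdd_ofAdd, hf]
      exact pow_dvd_pow _ (Nat.le_add_right _ _)
    rw [Subgroup.closure_le]
    intro x hx
    rcases Finset.mem_insert.1 hx with rfl | hx
    · exact hbmem
    · obtain ⟨i, -, rfl⟩ := Finset.mem_image.1 hx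
      exact hamem i
  · have hb : b ∈ Subgroup.closure (S : Set (Lamplighter p)) :=
      Subgroup.subset_closure (Finset.mem_insert_self _ _)
    have hbH : b ∈ lampSubgroup F k j := ⟨hbr ▸ dvd_rfl, hbt⟩
    obtain ⟨m, hm⟩ := hh.1
    have hc : h * b ^ (-m) ∈ lampSubgroup F k j :=
      mul_mem hh (zpow_mem hbH _)
    have hcr : (h * b ^ (-m)).right = 1 := by
      apply Multiplicative.toAdd.injective
      rw [SemidirectProduct.mul_right, toAdd_mul, Lamplighter.right_zpow, hm, hbr, toAdd_one]
      ring
    have hcl : SemidirectProduct.inl (h * b ^ (-m)).left = h * b ^ (-m) :=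
      SemidirectProduct.ext rfl hcr.symm
    have hct := hc.2
    rw [← hcl, lampTwist_inl] at hct
    have := inl_mem_of_X_pow_dvd hb hbr (fun i hi => ⟨f (j + i), Subgroup.subset_closure
      (Finset.mem_insert_of_mem (Finset.mem_image_of_mem a (Finset.mem_range.2 hi))), hf _⟩) hct
    rw [ofAdd_toAdd, hcl, Subgroup.mul_mem_cancel_right _ (Subgroup.zpow_mem _ hb _)] at this
    exact this

instance lampSubgroup_fg (F : (ZMod p)⟦X⟧) (k j : ℕ) : Group.FG (lampSubgroup F k j) := by
  obtain ⟨S, -, hS⟩ := exists_closure_eq_lampSubgroup F k j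
  exact (Group.fg_iff_subgroup_fg _).2 ⟨S, hS⟩

theorem rank_lampSubgroup (F : (ZMod p)⟦X⟧) (k j : ℕ) :
    Group.rank (lampSubgroup F k j) = p ^ k + 1 := by
  apply le_antisymm
  · obtain ⟨S, hcard, hS⟩ := exists_closure_eq_lampSubgroup F k j
    rw [← Subgroup.rank_congr hS]
    exact (Subgroup.rank_closure_finset_le_card S).trans hcard
  · have := finrank_le_rank_of_surjective p _ (lampSubgroupHom_surjective F k j)
    rwa [Module.finrank_prod, Module.finrank_pi, Fintype.card_fin, Module.finrank_self] at this

theorem iInf_lampSubgroup_eq_bot {F : (ZMod p)⟦X⟧}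
    (hF : ∀ s : ℤ, s ≠ 0 → ∀ f,
      (((oneAddXUnit p ^ s : (ZMod p)⟦X⟧ˣ) : (ZMod p)⟦X⟧) - 1) * F ≠ lampExpansion p f)
    {k j : ℕ → ℕ} (hj : Filter.Tendsto j Filter.atTop Filter.atTop) :
    ⨅ i, lampSubgroup F (k i) (j i) = ⊥ := by
  rw [eq_bot_iff]
  intro a ha
  rw [Subgroup.mem_iInf] at ha
  have ht : lampTwist F a = 0 := by
    ext n
    obtain ⟨i, hi⟩ := (hj.eventually_gt_atTop n).exists
    exact X_pow_dvd_iff.1 (ha i).2 n hi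
  rw [lampTwist, sub_eq_zero] at ht
  have hs : a.right.toAdd = 0 := by
    by_contra hs
    exact hF _ hs _ ht.symm
  rw [hs, zpow_zero, Units.val_one, sub_self, zero_mul] at ht
  rw [Subgroup.mem_bot]
  exact SemidirectProduct.ext (lampExpansion_injective (ht.trans (map_zero _).symm)) hs

end LamplighterRank

/-! ### Assembling the chain -/

theorem theorem4p2 (p : ℕ) (hp : p.Prime) (g : ℕ → ℕ)
    (h0 : g 0 = 2)
    (hstep : ∀ i, g (i + 1) = g i ∨ (g (i + 1) : ℤ) = p * g i - p + 1)
    (hinf : {i | g i = g (i + 1)}.Infinite) :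
    ∃ H : ℕ → Subgroup (Lamplighter p),
      IsSubnormalPChain p H ∧ H 0 = ⊤ ∧ (⨅ i, H i) = ⊥ ∧
      ∃ _ : ∀ i, Group.FG (H i),
        (∀ i, Group.rank (H i) = g i) ∧
        (∀ m, relativeRankGradient H m = ((g m : ℝ) - 1) / (p : ℝ) ^ m) ∧
        Filter.Tendsto (relativeRankGradient H) Filter.atTop (nhds 0) := by
  classical
  have : Fact p.Prime := ⟨hp⟩
  obtain ⟨F, hF⟩ := exists_forall_zpow_sub_one_mul_ne_lampExpansion (p := p)
  -- Before index `i`, `j i` counts the steps where `g` is stationary and `k i` the others.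
  set j : ℕ → ℕ := Nat.count fun i => g i = g (i + 1)
  set k : ℕ → ℕ := Nat.count fun i => ¬ g i = g (i + 1)
  have hj_succ (i : ℕ) : j (i + 1) = j i + if g i = g (i + 1) then 1 else 0 := Nat.count_succ _ i
  have hk_succ (i : ℕ) : k (i + 1) = k i + if ¬ g i = g (i + 1) then 1 else 0 := Nat.count_succ _ i
  have hg (i : ℕ) : g i = p ^ k i + 1 := by
    induction i with
    | zero => simp [h0, k]
    | succ i ih =>
      by_cases hi : g i = g (i + 1)
      · rw [hk_succ, if_neg (not_not.2 hi), add_zero, ← hi, ih]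
      · have h := (hstep i).resolve_left (Ne.symm hi)
        rw [ih] at h
        rw [hk_succ, if_pos hi, pow_succ]
        zify
        rw [h]
        push_cast
        ring
  have hjk (i : ℕ) : j i + k i = i := by
    induction i with
    | zero => simp [j, k]
    | succ i ih => rw [hj_succ, hk_succ]; split_ifs <;> omega
  have hj : Filter.Tendsto j Filter.atTop Filter.atTop :=
    Filter.tendsto_atTop_atTop_of_monotone (Nat.count_monotone _) fun n =>
      ⟨Nat.nth _ n, (Nat.count_nth_of_infinite hinf n).ge⟩
  set H : ℕ → Subgroup (Lamplighter p) := fun i => lampSubgroup F (k i) (j i) with hH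
  have hstepH (i : ℕ) : H (i + 1) ≤ H i ∧ ((H (i + 1)).subgroupOf (H i)).Normal ∧
      (H (i + 1)).relIndex (H i) = p := by
    simp only [hH, hj_succ, hk_succ]
    by_cases hi : g i = g (i + 1)
    · simpa only [hi, not_true, if_true, if_false, add_zero] using
        lampSubgroup_succ_right F (k i) (j i)
    · simpa only [hi, not_false_eq_true, if_true, if_false, add_zero] using
        lampSubgroup_succ_left F (k i) (j i)
  have hchain : IsSubnormalPChain p H :=
    ⟨fun i => (hstepH i).1, fun i => (hstepH i).2.1, fun i => (hstepH i).2.2⟩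
  have hH0 : H 0 = ⊤ := by simp [hH, j, k, lampSubgroup_zero_zero]
  have hfg (i : ℕ) : Group.FG (H i) := lampSubgroup_fg F _ _
  have hrank (i : ℕ) : Group.rank (H i) = g i := by
    rw [hg]
    exact rank_lampSubgroup F _ _
  have hrg (m : ℕ) : relativeRankGradient H m = ((g m : ℝ) - 1) / (p : ℝ) ^ m := by
    rw [relativeRankGradient, hrank, hchain.index_eq hH0, Nat.cast_pow]
  refine ⟨H, hchain, hH0, iInf_lampSubgroup_eq_bot hF hj, hfg, hrank, hrg, ?_⟩
  have hp1 : (1 : ℝ) < p := by exact_mod_cast hp.one_lt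
  -- The gradient is `p ^ k m / p ^ m`, and `j m + k m = m`.
  have heq : relativeRankGradient H = fun m => ((p : ℝ)⁻¹) ^ j m := by
    funext m
    have hp0 : (p : ℝ) ≠ 0 := by positivity
    have hm : (p : ℝ) ^ m = p ^ j m * p ^ k m := by rw [← pow_add, hjk]
    rw [hrg, hg, hm, Nat.cast_add, Nat.cast_pow, Nat.cast_one, add_sub_cancel_right, inv_pow]
    field_simp
  rw [heq]
  exact (tendsto_pow_atTop_nhds_zero_of_lt_one (by positivity) (inv_lt_one_of_one_lt₀ hp1)).comp hj
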